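/- **Theorem (passive lower bound).** Let $d\ge 2$, $\alpha>0$, $\kappa>1$, $\kappa'>\kappa-1$, $\lambda\ge 1$, $0<c<2^{\kappa-2}$, $M>0$ and $\Delta_0>0$. Write $x=(\tilde x,x_d)\in[0,1]^{d-1}\times[0,1]$, and for $\beta>0$ let $\lfloor\beta\rfloor$ be the largest integer strictly smaller than $\beta$. Let $\Sigma(\lambda,\alpha)$ be the set of functions $g:[0,1]^{d-1}\to[0,1]$ that are $\lfloor\alpha\rfloor$ times continuously differentiable and satisfy $|g(x)-\mathrm{TP}_{y,\lfloor\beta\rfloor}(x)|\le\lambda\|x-y\|_\infty^\beta$ for all $x,y\in[0,1]^{d-1}$ and all $0<\beta\le\alpha$, where $\mathrm{TP}_{y,k}$ is the Taylor polynomial of $g$ of degree $k$ at $y$. Let $\mathcal P$ be the set of all laws $\mathbb P_{X,Y}$ on $[0,1]^d\times\{0,1\}$, given by a marginal law $\mathbb P_X$ and a regression function $\eta(x)=\mathbb P(Y=1\mid X=x)$, for which there is $g^*\in\Sigma(\lambda,\alpha)$ such that 1. $\{x\in[0,1]^d:\eta(x)\ge 1/2\}=\{x\in[0,1]^d: x_d\ge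 g^*(\tilde x)\}$; 2. $|\eta(x)-1/2|\ge c\,|x_d-g^*(\tilde x)|^{\kappa-1}$ for all $x\in[0,1]^d$; 3. $\displaystyle\int_{\{x\in[0,1]^d:\,|x_d-g^*(\tilde x)|\le\Delta\}}|1-2\eta(x)|\,d\mathbb P_X(x)\le M\Delta^{\kappa'}$ for all $\Delta\in[0,\Delta_0]$. For a classifier $f:[0,1]^d\to\{0,1\}$ let $\mathcal E(f)=\mathbb P_{X,Y}(f(X)\ne Y)-\mathbb P_{X,Y}(f^*(X)\ne Y)$, where $f^*=\mathbf 1\{\eta\ge 1/2\}$. Then there are $C>0$ and $N$, not depending on $n$, such that for all $n\ge N$ $$\inf_{\widehat f_n}\ \sup_{\mathbb P_{X,Y}\in\mathcal P}\ \mathbb E\big[\mathcal E(\widehat f_n)\big]\ \ge\ C\,n^{-\alpha\kappa'/(\alpha(\kappa+\kappa'-1)+d-1)},$$ where the infimum is over all classifiers $\widehat f_n$ trained on $n$ i.i.d. samples of $\mathbb P_{X,Y}$. This rate is strictly slower than the active rate $n^{-\alpha\kappa'/(2\alpha(\kappa-1)+d-1)}$, even up to logarithmic factors: $$\frac{\alpha\kappa'}{\alpha(\kappa+\kappa'-1)+d-1}<\frac{\alpha\kappa'}{2\alpha(\kappa-1)+d-1},$$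 and for every real $q$, $(\log n)^q\,n^{-\alpha\kappa'/(2\alpha(\kappa-1)+d-1)}=o\big(n^{-\alpha\kappa'/(\alpha(\kappa+\kappa'-1)+d-1)}\big)$ as $n\to\infty$. -/

import Mathlib

open MeasureTheory Set Filter Asymptotics
open scoped ENNReal Topology

noncomputable section

/-- The feature space `ℝ^{d-1} × ℝ`, in which a point is written `x = (x̃, x_d)`. -/
abbrev FeatureSpace (d : ℕ) : Type := (Fin (d - 1) → ℝ) × ℝ

/-- The unit cube `[0,1]^{d-1} × [0,1] = [0,1]^d`. -/
def unitCube (d : ℕ) : Set (FeatureSpace d) := Icc 0 1 ×ˢ Icc 0 1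

/-- The largest integer strictly smaller than `a`, for `a > 0`. -/
def strictFloor (a : ℝ) : ℕ := ⌈a⌉₊ - 1

/-- The value at `x` of the Taylor polynomial of degree `k` of `g : [0,1]^m → ℝ` at `y`. The
derivatives are those of `g` as a function on the closed cube (one-sided at its boundary). -/
def taylorPoly {m : ℕ} (k : ℕ) (g : (Fin m → ℝ) → ℝ) (y x : Fin m → ℝ) : ℝ :=
  ∑ j ∈ Finset.range (k + 1),
    (j.factorial : ℝ)⁻¹ * iteratedFDerivWithin ℝ j g (Icc 0 1) y (fun _ => x - y)

/-- The Hölder class `Σ(lam, α)` of functions `g : [0,1]^m → [0,1]`; the norm of `Fin m → ℝ` is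
the maximum norm. -/
def HolderClass (m : ℕ) (lam α : ℝ) : Set ((Fin m → ℝ) → ℝ) :=
  {g | MapsTo g (Icc 0 1) (Icc 0 1) ∧
    ContDiffOn ℝ (strictFloor α) g (Icc 0 1) ∧
    ∀ x ∈ Icc (0 : Fin m → ℝ) 1, ∀ y ∈ Icc (0 : Fin m → ℝ) 1, ∀ β : ℝ, 0 < β → β ≤ α →
      |g x - taylorPoly (strictFloor β) g y x| ≤ lam * ‖x - y‖ ^ β}

/-- The epigraph of `g` in the unit cube. -/
def epi {d : ℕ} (g : (Fin (d - 1) → ℝ) → ℝ) : Set (FeatureSpace d) :=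
  {x | x ∈ unitCube d ∧ g x.1 ≤ x.2}

/-- A binary classification problem on `[0,1]^d`, given by the marginal law of the feature and by
the regression function `η(x) = P(Y = 1 | X = x)`. -/
structure ClassificationProblem (d : ℕ) where
  /-- the law of the feature `X` -/
  marginal : Measure (FeatureSpace d)
  isProb : IsProbabilityMeasure marginal
  supported : marginal (unitCube d)ᶜ = 0
  /-- the regression function; only its values on the cube matter -/
  eta : FeatureSpace d → ℝ
  measurable_eta : Measurable eta
  eta_mem : ∀ x ∈ unitCube d, eta x ∈ Icc (0 : ℝ) 1

namespace ClassificationProblem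

variable {d : ℕ}

/-- The joint law of `(X, Y)`; the label `1` is `true` and the label `0` is `false`. -/
def joint (P : ClassificationProblem d) : Measure (FeatureSpace d × Bool) :=
  (P.marginal.withDensity fun x => ENNReal.ofReal (P.eta x)).map (fun x => (x, true)) +
  (P.marginal.withDensity fun x => ENNReal.ofReal (1 - P.eta x)).map (fun x => (x, false))

/-- The `0`-`1` risk `P(Y ≠ f(X))`. -/
def risk (P : ClassificationProblem d) (f : FeatureSpace d → Bool) : ℝ :=
  P.joint.real {z | z.2 ≠ f z.1}

/-- The Bayes classifier `1{η ≥ 1/2}`. -/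
def bayes (P : ClassificationProblem d) : FeatureSpace d → Bool :=
  fun x => decide (1 / 2 ≤ P.eta x)

/-- The excess risk of a classifier over the Bayes classifier. -/
def excessRisk (P : ClassificationProblem d) (f : FeatureSpace d → Bool) : ℝ :=
  P.risk f - P.risk P.bayes

end ClassificationProblem

/-- The class of problems on `[0,1]^d` whose decision boundary is the graph of some
`g ∈ Σ(lam, α)`, with the noise condition of exponent `κ` and constant `c`, and with the condition
of exponent `κ'` and constants `M`, `Δ₀` on the risk carried by neighbourhoods of the boundary. -/
def problemClass (d : ℕ) (lam α c κ M Δ₀ κ' : ℝ) : Set (ClassificationProblem d) :=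
  {P | ∃ g ∈ HolderClass (d - 1) lam α,
    {x | x ∈ unitCube d ∧ 1 / 2 ≤ P.eta x} = epi g ∧
    (∀ x ∈ unitCube d, c * |x.2 - g x.1| ^ (κ - 1) ≤ |P.eta x - 1 / 2|) ∧
    ∀ Δ ∈ Icc 0 Δ₀,
      ∫ x in {x | x ∈ unitCube d ∧ |x.2 - g x.1| ≤ Δ}, |1 - 2 * P.eta x| ∂P.marginal
        ≤ M * Δ ^ κ'}

/-- The passive learning rules: (jointly measurable) maps from `n` labelled samples to
classifiers. -/
def PassiveRule (d n : ℕ) : Set ((Fin n → FeatureSpace d × Bool) → FeatureSpace d → Bool) :=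
  {f | Measurable (Function.uncurry f)}

/-- The expected excess risk, under `P`, of the classifier that the rule `f` returns on `n` i.i.d.
samples of `P`. -/
def expectedExcessRisk {d n : ℕ} (P : ClassificationProblem d)
    (f : (Fin n → FeatureSpace d × Bool) → FeatureSpace d → Bool) : ℝ≥0∞ :=
  ∫⁻ D, ENNReal.ofReal (P.excessRisk (f D)) ∂(Measure.pi fun _ : Fin n => P.joint)

/-- The passive minimax expected excess risk over a class of problems. -/
def passiveMinimaxRisk {d : ℕ} (S : Set (ClassificationProblem d)) (n : ℕ) : ℝ≥0∞ :=
  ⨅ f ∈ PassiveRule d n, ⨆ P ∈ S, expectedExcessRisk P f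

/-- The exponent of the active rate. -/
def activeExponent (d : ℕ) (α κ κ' : ℝ) : ℝ := α * κ' / (2 * α * (κ - 1) + (d - 1))

/-- The exponent of the passive rate. -/
def passiveExponent (d : ℕ) (α κ κ' : ℝ) : ℝ := α * κ' / (α * (κ + κ' - 1) + (d - 1))

end

/-! The proof is a finite hypercube argument. Cut `[0,1]^(d-1)` into `L^(d-1)` cells and let the
boundary be `1/2` plus a bump of height `±δ` in each cell, with `δ = A * L^(-α)`. Derivatives of
order `j` then have size `L^(j-α)`, and the bumps have disjoint supports, so every sign pattern
stays in the Hölder class for small `A` (`exists_boundaryFun_mem_HolderClass`).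

The marginal puts mass `w` uniformly on the points of height `1/2` over the cell centres. There the
sign of the bump decides the Bayes label, and the label has bias only `ε = c * δ^(κ-1)`. The
remaining mass sits at one point that lies on every boundary: its label is a fair coin, so it
carries neither information nor excess risk. The condition with exponent `κ'` then reduces to `2wε ≤
M * δ^κ'`, which allows `w` of order `δ^(κ'-κ+1)`.

Flipping one sign lowers the Hellinger affinity of one sample by at most `4wε²/L^(d-1)`. While
`16nwε² ≤ L^(d-1)`, Assouad's lemma (`exists_card_div_eight_le_expected_errors`) makes every rule
err on an eighth of the sites, at an excess risk of at least `wε/4` (`le_passiveMinimaxRisk`). Since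
`wε²` is of order `δ^(κ+κ'-1)`, the choice `L ~ n^(1/(α(κ+κ'-1)+d-1))` is allowed, and `wε ~ δ^κ' ~
L^(-ακ')` is the rate. -/

/-! ### Taylor remainders in several variables. -/

section Taylor

variable {E : Type*} [NormedAddCommGroup E] [NormedSpace ℝ E]

lemma abs_iteratedFDeriv_diag_le {g : E → ℝ} {n : ℕ} {C : ℝ} {z : E}
    (hC : ‖iteratedFDeriv ℝ n g z‖ ≤ C) (v : E) :
    |iteratedFDeriv ℝ n g z (fun _ => v)| ≤ C * ‖v‖ ^ n := by
  have h := (iteratedFDeriv ℝ n g z).le_of_opNorm_le hC (fun _ => v)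
  simpa using h

/-- Taylor's theorem with a uniform bound on the remainder, for functions of several variables. -/
lemma abs_sub_taylor_le {g : E → ℝ} {n : ℕ} {C : ℝ} (hg : ContDiff ℝ (n + 1) g)
    (hC : ∀ z, ‖iteratedFDeriv ℝ (n + 1) g z‖ ≤ C) (x y : E) :
    |g x - ∑ j ∈ Finset.range (n + 1),
      (j.factorial : ℝ)⁻¹ * iteratedFDeriv ℝ j g y (fun _ => x - y)| ≤ C * ‖x - y‖ ^ (n + 1) := by
  have h := map_add_eq_sum_add_integral_iteratedFDeriv (f := g) (x := y) (y := x - y) (n := n)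
    fun t _ => hg.contDiffAt
  simp only [smul_eq_mul, add_sub_cancel] at h
  rw [h, add_sub_cancel_left, abs_mul]
  have hC0 : 0 ≤ C := (norm_nonneg _).trans (hC 0)
  have hint : ‖∫ t in (0 : ℝ)..1, (1 - t) ^ n *
      iteratedFDeriv ℝ (n + 1) g (y + t • (x - y)) (fun _ => x - y)‖
      ≤ C * ‖x - y‖ ^ (n + 1) * |1 - 0| := by
    refine intervalIntegral.norm_integral_le_of_norm_le_const fun t ht => ?_
    rw [uIoc_of_le zero_le_one] at ht
    rw [norm_mul, norm_pow]
    have h1 : ‖(1 : ℝ) - t‖ ≤ 1 := by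
      rw [Real.norm_eq_abs, abs_le]; constructor <;> linarith [ht.1, ht.2]
    calc _ ≤ 1 * (C * ‖x - y‖ ^ (n + 1)) :=
          mul_le_mul (pow_le_one₀ (norm_nonneg _) h1) (abs_iteratedFDeriv_diag_le (hC _) _)
            (abs_nonneg _) zero_le_one
      _ = _ := one_mul _
  rw [sub_zero, abs_one, mul_one, Real.norm_eq_abs] at hint
  have hf : |((n.factorial : ℝ))⁻¹| ≤ 1 := by
    rw [abs_of_nonneg (by positivity)]
    exact inv_le_one_of_one_le₀ (by exact_mod_cast n.factorial_pos)
  calc _ ≤ 1 * (C * ‖x - y‖ ^ (n + 1)) := mul_le_mul hf hint (abs_nonneg _) zero_le_one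
    _ = _ := one_mul _

end Taylor

/-! ### Membership in the Hölder class from derivative bounds. -/

lemma strictFloor_add_one {β : ℝ} (hβ : 0 < β) : strictFloor β + 1 = ⌈β⌉₊ :=
  Nat.sub_add_cancel (Nat.ceil_pos.2 hβ)

lemma strictFloor_lt {β : ℝ} (hβ : 0 < β) : (strictFloor β : ℝ) < β :=
  Nat.lt_ceil.1 (by rw [← strictFloor_add_one hβ]; exact Nat.lt_succ_self _)

lemma le_strictFloor_add_one {β : ℝ} (hβ : 0 < β) : β ≤ (strictFloor β : ℝ) + 1 := by
  have := Nat.le_ceil β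
  rw [← strictFloor_add_one hβ] at this
  exact_mod_cast this

lemma uniqueDiffOn_Icc_pi (m : ℕ) : UniqueDiffOn ℝ (Icc (0 : Fin m → ℝ) 1) := by
  rw [← pi_univ_Icc]
  exact UniqueDiffOn.univ_pi fun i => uniqueDiffOn_Icc (by simp)

/-- The closed cube is a set of unique differentiability, so even at its boundary the derivatives
within it of a globally smooth function are the ordinary ones. -/
lemma taylorPoly_eq {m : ℕ} {k : ℕ} {g : (Fin m → ℝ) → ℝ} (hg : ContDiff ℝ k g)
    {y : Fin m → ℝ} (hy : y ∈ Icc (0 : Fin m → ℝ) 1) (x : Fin m → ℝ) :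
    taylorPoly k g y x = ∑ j ∈ Finset.range (k + 1),
      (j.factorial : ℝ)⁻¹ * iteratedFDeriv ℝ j g y (fun _ => x - y) := by
  refine Finset.sum_congr rfl fun j hj => ?_
  rw [iteratedFDerivWithin_eq_iteratedFDeriv (uniqueDiffOn_Icc_pi m) _ hy]
  refine (hg.of_le ?_).contDiffAt
  exact_mod_cast Nat.lt_succ_iff.1 (Finset.mem_range.1 hj)

/-- A smooth function that oscillates around `1/2` at scale `L⁻¹` with amplitude `L ^ (-α)` belongs
to the Hölder class. -/
lemma mem_HolderClass_of_bounds {m : ℕ} {lam α B L : ℝ} {g : (Fin m → ℝ) → ℝ} (hlam : 1 ≤ lam)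
    (hα : 0 < α) (hL : 1 ≤ L) (hB : 0 ≤ B) (hB2 : 2 * B ≤ 1) (hg : ContDiff ℝ ⌈α⌉₊ g)
    (h0 : ∀ z, |g z - 1 / 2| ≤ B * L ^ (-α))
    (hj : ∀ j, 1 ≤ j → j ≤ ⌈α⌉₊ → ∀ z, ‖iteratedFDeriv ℝ j g z‖ ≤ B * L ^ (-α) * L ^ j) :
    g ∈ HolderClass m lam α := by
  have hL0 : 0 < L := by linarith
  have hLα : L ^ (-α) ≤ 1 := Real.rpow_le_one_of_one_le_of_nonpos hL (by linarith)
  have hLα0 : 0 < L ^ (-α) := Real.rpow_pos_of_pos hL0 _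
  refine ⟨fun z _ => ?_, (hg.of_le ?_).contDiffOn, fun x hx y hy β hβ hβα => ?_⟩
  · have h1 := abs_le.1 (h0 z)
    have : B * L ^ (-α) ≤ 1 / 2 := by nlinarith
    constructor <;> linarith
  · rw [← strictFloor_add_one hα]; exact_mod_cast Nat.le_succ _
  · set k := strictFloor β with hk
    have hk1 : k + 1 ≤ ⌈α⌉₊ := by
      rw [hk, strictFloor_add_one hβ]; exact Nat.ceil_mono hβα
    have hgk : ∀ i, i ≤ ⌈α⌉₊ → ContDiff ℝ i g := fun i hi => hg.of_le (by exact_mod_cast hi)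
    rw [taylorPoly_eq (hgk k (by omega)) hy]
    set r := ‖x - y‖ with hr
    have hr0 : 0 ≤ r := norm_nonneg _
    set s := L * r with hs
    have hs0 : 0 ≤ s := by positivity
    set R := |g x - ∑ j ∈ Finset.range (k + 1),
      (j.factorial : ℝ)⁻¹ * iteratedFDeriv ℝ j g y (fun _ => x - y)| with hR
    have hR1 : R ≤ B * L ^ (-α) * s ^ (k + 1) := by
      refine (abs_sub_taylor_le (hgk _ hk1) (hj _ (by omega) hk1) x y).trans_eq ?_
      rw [hs, mul_pow]; ring
    -- For `s ≥ 1` the power `s ^ (k + 1)` is too large. Moving the top term out of the Taylor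
    -- polynomial leaves the remainder of degree `k - 1` plus a term of order `k`; for `k = 0` the
    -- oscillation around `1/2` takes this role.
    have hR2 : R ≤ 2 * (B * L ^ (-α)) * s ^ k := by
      rcases Nat.eq_zero_or_pos k with h | h
      · have hR' : R = |(g x - 1 / 2) - (g y - 1 / 2)| := by
          rw [hR, h]; simp
        rw [hR', h, pow_zero, mul_one]
        refine (abs_sub _ _).trans ?_
        linarith [h0 x, h0 y]
      · obtain ⟨i, hi⟩ : ∃ i, k = i + 1 := ⟨k - 1, by omega⟩
        have h1 := abs_sub_taylor_le (hgk (i + 1) (by omega)) (hj (i + 1) (by omega) (by omega)) x y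
        have h2 := abs_iteratedFDeriv_diag_le (hj (i + 1) (by omega) (by omega) y) (x - y)
        have hf : |(((i + 1).factorial : ℝ))⁻¹| ≤ 1 := by
          rw [abs_of_nonneg (by positivity)]
          exact inv_le_one_of_one_le₀ (by exact_mod_cast (i + 1).factorial_pos)
        rw [hR, hi, Finset.sum_range_succ, ← sub_sub]
        refine (abs_sub _ _).trans ?_
        rw [abs_mul]
        have h3 := mul_le_mul hf h2 (abs_nonneg _) zero_le_one
        rw [hs, mul_pow]
        linarith
    -- As `k < β ≤ k + 1`, the power `s ^ β` dominates `s ^ (k + 1)` for `s ≤ 1` and `s ^ k` for `s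
    -- ≥ 1`.
    have hsβ : R ≤ 2 * (B * L ^ (-α)) * s ^ β := by
      rcases le_total s 1 with h | h
      · have h1 : s ^ (k + 1) ≤ s ^ β := by
          rw [← Real.rpow_natCast]
          refine Real.rpow_le_rpow_of_exponent_ge' hs0 h hβ.le ?_
          push_cast; exact le_strictFloor_add_one hβ
        have h2 := mul_le_mul_of_nonneg_left h1 (by positivity : 0 ≤ B * L ^ (-α))
        have h3 : 0 ≤ B * L ^ (-α) * s ^ β := by positivity
        linarith
      · have h1 : s ^ k ≤ s ^ β := by
          rw [← Real.rpow_natCast]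
          exact Real.rpow_le_rpow_of_exponent_le h (strictFloor_lt hβ).le
        exact hR2.trans (mul_le_mul_of_nonneg_left h1 (by positivity))
    have hLβ : L ^ (-α) * L ^ β ≤ 1 := by
      rw [← Real.rpow_add hL0]
      exact Real.rpow_le_one_of_one_le_of_nonpos hL (by linarith)
    calc R ≤ 2 * (B * L ^ (-α)) * s ^ β := hsβ
      _ = 2 * B * (L ^ (-α) * L ^ β) * r ^ β := by
          rw [hs, Real.mul_rpow hL0.le hr0]; ring
      _ ≤ 1 * 1 * r ^ β := by gcongr
      _ ≤ lam * r ^ β := by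
          rw [one_mul]; gcongr

/-! ### Bump functions on a grid and the boundary functions. -/

section Bumps

variable {m L : ℕ}

/-- The centre of the `j`-th cell of the unit grid on `[0, L]^m`. -/
noncomputable def cellCenter (j : Fin m → Fin L) : Fin m → ℝ := fun i => (j i : ℝ) + 1 / 2

/-- A smooth bump supported in the ball of radius `1/4`. -/
noncomputable def unitBump (m : ℕ) : ContDiffBump (0 : Fin m → ℝ) :=
  ⟨1 / 8, 1 / 4, by norm_num, by norm_num⟩

/-- The superposition of bumps in the cells of the unit grid, with coefficients `e`. -/
noncomputable def bumpSum (e : (Fin m → Fin L) → ℝ) (u : Fin m → ℝ) : ℝ :=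
  ∑ j, e j * unitBump m (u - cellCenter j)

lemma one_le_norm_cellCenter_sub {j j' : Fin m → Fin L} (h : j ≠ j') :
    1 ≤ ‖cellCenter j - cellCenter j'‖ := by
  obtain ⟨i, hi⟩ := Function.ne_iff.1 h
  refine le_trans ?_ (norm_le_pi_norm _ i)
  have hi' : ((j i : ℕ) : ℤ) - ((j' i : ℕ) : ℤ) ≠ 0 := fun h => hi (Fin.ext (by omega))
  have := Int.one_le_abs hi'
  have h2 : (1 : ℝ) ≤ |((j i : ℕ) : ℝ) - ((j' i : ℕ) : ℝ)| := by exact_mod_cast this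
  simpa [cellCenter] using h2

/-- At most one of the bumps is active at a given point. -/
lemma norm_sum_bumps_le {F : Type*} [SeminormedAddCommGroup F] {a : (Fin m → Fin L) → F}
    {u : Fin m → ℝ} {K : ℝ} (hK : 0 ≤ K) (ha : ∀ j, ‖a j‖ ≤ K)
    (h0 : ∀ j, 1 / 4 < ‖u - cellCenter j‖ → a j = 0) : ‖∑ j, a j‖ ≤ K := by
  by_cases h : ∃ j : Fin m → Fin L, ‖u - cellCenter j‖ ≤ 1 / 4
  · obtain ⟨j, hj⟩ := h
    rw [Finset.sum_eq_single j]
    · exact ha j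
    · intro j' _ hne
      refine h0 j' ?_
      by_contra! hc
      have h1 := one_le_norm_cellCenter_sub hne
      have h2 : cellCenter j' - cellCenter j = (u - cellCenter j) - (u - cellCenter j') := by abel
      rw [h2] at h1
      linarith [norm_sub_le (u - cellCenter j) (u - cellCenter j')]
    · simp
  · push Not at h
    rw [Finset.sum_eq_zero fun j _ => h0 j (h j), norm_zero]
    exact hK

lemma unitBump_iteratedFDeriv_eq_zero (i : ℕ) {v : Fin m → ℝ} (hv : 1 / 4 < ‖v‖) :
    iteratedFDeriv ℝ i (unitBump m) v = 0 := by
  by_contra h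
  have h1 := support_iteratedFDeriv_subset (𝕜 := ℝ) (f := unitBump m) i (Function.mem_support.2 h)
  rw [(unitBump m).tsupport_eq, mem_closedBall_zero_iff] at h1
  exact absurd hv (not_lt.2 h1)

/-- Each derivative is continuous with compact support. The bound does not involve `L`, and `1 ≤ K`
lets it serve for the values of the bump as well. -/
lemma exists_bound_iteratedFDeriv_unitBump (m N : ℕ) :
    ∃ K : ℝ, 1 ≤ K ∧ ∀ i ≤ N, ∀ v, ‖iteratedFDeriv ℝ i (unitBump m) v‖ ≤ K := by
  have h : ∀ i : ℕ, ∃ K : ℝ, ∀ v, ‖iteratedFDeriv ℝ i (unitBump m) v‖ ≤ K := fun i =>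
    ((unitBump m).hasCompactSupport.iteratedFDeriv i).exists_bound_of_continuous
      (((unitBump m).contDiff (n := ⊤)).continuous_iteratedFDeriv (by exact_mod_cast le_top))
  choose K hK using h
  have hK0 : ∀ i, 0 ≤ K i := fun i => (norm_nonneg _).trans (hK i 0)
  refine ⟨1 + ∑ i ∈ Finset.range (N + 1), K i, ?_, fun i hi v => (hK i v).trans ?_⟩
  · linarith [Finset.sum_nonneg fun i (_ : i ∈ Finset.range (N + 1)) => hK0 i]
  · have := Finset.single_le_sum (f := K) (fun i _ => hK0 i)
      (Finset.mem_range.2 (Nat.lt_succ_of_le hi))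
    linarith

lemma contDiff_bumpTerm (a : ℝ) (j : Fin m → Fin L) (n : ℕ) :
    ContDiff ℝ n fun u => a * unitBump m (u - cellCenter j) :=
  contDiff_const.mul (((unitBump m).contDiff (n := n)).comp (contDiff_id.sub contDiff_const))

lemma contDiff_bumpSum (e : (Fin m → Fin L) → ℝ) (n : ℕ) : ContDiff ℝ n (bumpSum e) :=
  ContDiff.sum fun j _ => contDiff_bumpTerm (e j) j n

/-- Supports are disjoint, so the bound for a single bump survives whatever the number of cells. -/
lemma norm_iteratedFDeriv_bumpSum_le {e : (Fin m → Fin L) → ℝ} (he : ∀ j, |e j| ≤ 1) {i : ℕ}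
    {K : ℝ} (hK : ∀ v, ‖iteratedFDeriv ℝ i (unitBump m) v‖ ≤ K) (u : Fin m → ℝ) :
    ‖iteratedFDeriv ℝ i (bumpSum e) u‖ ≤ K := by
  have hterm : ∀ j, iteratedFDeriv ℝ i (fun u => e j * unitBump m (u - cellCenter j)) u
      = e j • iteratedFDeriv ℝ i (unitBump m) (u - cellCenter j) := by
    intro j
    rw [← iteratedFDeriv_comp_sub]
    exact iteratedFDeriv_const_smul_apply' (a := e j)
      (((unitBump m).contDiff (n := i)).comp (contDiff_id.sub contDiff_const)).contDiffAt
  have hK0 : 0 ≤ K := (norm_nonneg _).trans (hK 0)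
  have hsum : iteratedFDeriv ℝ i (bumpSum e) u
      = ∑ j, e j • iteratedFDeriv ℝ i (unitBump m) (u - cellCenter j) := by
    rw [← Finset.sum_congr rfl fun j _ => hterm j]
    exact iteratedFDeriv_fun_sum_apply fun j _ => (contDiff_bumpTerm (e j) j i).contDiffAt
  rw [hsum]
  refine norm_sum_bumps_le (u := u) hK0 (fun j => ?_) fun j hj => ?_
  · rw [norm_smul, Real.norm_eq_abs]
    calc _ ≤ 1 * K := mul_le_mul (he j) (hK _) (norm_nonneg _) zero_le_one
      _ = K := one_mul K
  · rw [unitBump_iteratedFDeriv_eq_zero i hj, smul_zero]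

lemma abs_bumpSum_le {e : (Fin m → Fin L) → ℝ} (he : ∀ j, |e j| ≤ 1) (u : Fin m → ℝ) :
    |bumpSum e u| ≤ 1 := by
  refine norm_sum_bumps_le (u := u) (F := ℝ) zero_le_one (fun j => ?_) fun j hj => ?_
  · rw [norm_mul, Real.norm_eq_abs, Real.norm_eq_abs, abs_of_nonneg (unitBump m).nonneg]
    exact mul_le_one₀ (he j) (unitBump m).nonneg (unitBump m).le_one
  · rw [(unitBump m).zero_of_le_dist (by rw [dist_zero_right]; exact hj.le), mul_zero]

lemma bumpSum_cellCenter (e : (Fin m → Fin L) → ℝ) (j : Fin m → Fin L) :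
    bumpSum e (cellCenter j) = e j := by
  rw [bumpSum, Finset.sum_eq_single j]
  · rw [sub_self, (unitBump m).one_of_mem_closedBall
      (Metric.mem_closedBall_self (unitBump m).rIn_pos.le), mul_one]
  · intro j' _ hne
    rw [(unitBump m).zero_of_le_dist, mul_zero]
    rw [dist_zero_right]
    exact le_trans (by norm_num [unitBump]) (one_le_norm_cellCenter_sub hne.symm)
  · simp

/-- The origin is a corner of the grid, at distance at least `1/2` from every centre. Without
coordinates (`m = 0`) it would itself be a centre. -/
lemma bumpSum_zero (hm : 0 < m) (e : (Fin m → Fin L) → ℝ) : bumpSum e 0 = 0 := by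
  refine Finset.sum_eq_zero fun j _ => ?_
  rw [(unitBump m).zero_of_le_dist, mul_zero]
  rw [dist_zero_right]
  refine le_trans ?_ (norm_le_pi_norm _ ⟨0, hm⟩)
  have : (0 : ℝ) ≤ ((j ⟨0, hm⟩ : ℕ) : ℝ) := Nat.cast_nonneg _
  rw [Pi.sub_apply, Pi.zero_apply, zero_sub, norm_neg, Real.norm_eq_abs, cellCenter,
    abs_of_nonneg (by positivity)]
  simp only [unitBump]
  linarith

/-- The boundary functions of the lower bound: `1/2` plus bumps of width `L⁻¹` and height `δ`. -/
noncomputable def boundaryFun (δ : ℝ) (e : (Fin m → Fin L) → ℝ) (x : Fin m → ℝ) : ℝ :=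
  1 / 2 + δ * bumpSum e ((L : ℝ) • x)

lemma boundaryFun_zero (hm : 0 < m) (δ : ℝ) (e : (Fin m → Fin L) → ℝ) :
    boundaryFun δ e 0 = 1 / 2 := by
  simp [boundaryFun, bumpSum_zero hm]

lemma boundaryFun_center (hL : 0 < L) (δ : ℝ) (e : (Fin m → Fin L) → ℝ) (j : Fin m → Fin L) :
    boundaryFun δ e ((L : ℝ)⁻¹ • cellCenter j) = 1 / 2 + δ * e j := by
  rw [boundaryFun, smul_inv_smul₀ (by positivity), bumpSum_cellCenter]

lemma contDiff_boundaryFun (δ : ℝ) (e : (Fin m → Fin L) → ℝ) (n : ℕ) :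
    ContDiff ℝ n (boundaryFun δ e) :=
  contDiff_const.add (contDiff_const.mul
    ((contDiff_bumpSum e n).comp (contDiff_const_smul (L : ℝ))))

lemma abs_boundaryFun_sub_le {δ : ℝ} (hδ : 0 ≤ δ) {e : (Fin m → Fin L) → ℝ}
    (he : ∀ j, |e j| ≤ 1) (x : Fin m → ℝ) : |boundaryFun δ e x - 1 / 2| ≤ δ := by
  rw [boundaryFun, add_sub_cancel_left, abs_mul, abs_of_nonneg hδ]
  exact mul_le_of_le_one_right hδ (abs_bumpSum_le he _)

lemma norm_iteratedFDeriv_boundaryFun_le {δ : ℝ} (hδ : 0 ≤ δ) {e : (Fin m → Fin L) → ℝ}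
    (he : ∀ j, |e j| ≤ 1) {i : ℕ} (hi : 1 ≤ i) {K : ℝ}
    (hK : ∀ v, ‖iteratedFDeriv ℝ i (unitBump m) v‖ ≤ K) (x : Fin m → ℝ) :
    ‖iteratedFDeriv ℝ i (boundaryFun δ e) x‖ ≤ δ * K * (L : ℝ) ^ i := by
  have h1 : iteratedFDeriv ℝ i (boundaryFun δ e) x
      = δ • ((L : ℝ) ^ i • iteratedFDeriv ℝ i (bumpSum e) ((L : ℝ) • x)) := by
    have hc : ContDiff ℝ i fun z : Fin m → ℝ => bumpSum e ((L : ℝ) • z) :=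
      (contDiff_bumpSum e i).comp (contDiff_const_smul (L : ℝ))
    have h2 := congrFun (iteratedFDeriv_comp_const_smul (L : ℝ) (contDiff_bumpSum e i)) x
    rw [← h2, ← iteratedFDeriv_const_smul_apply' hc.contDiffAt]
    have h3 : boundaryFun δ e
        = (fun _ => (1 / 2 : ℝ)) + fun z => δ • bumpSum e ((L : ℝ) • z) := rfl
    have hc' : ContDiff ℝ i fun z : Fin m → ℝ => δ • bumpSum e ((L : ℝ) • z) :=
      contDiff_const.mul hc
    rw [h3, iteratedFDeriv_add_apply contDiff_const.contDiffAt hc'.contDiffAt,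
      iteratedFDeriv_const_of_ne (by omega), Pi.zero_apply, zero_add]
  rw [h1, norm_smul, norm_smul, norm_pow, Real.norm_of_nonneg hδ,
    Real.norm_of_nonneg (Nat.cast_nonneg L)]
  have := norm_iteratedFDeriv_bumpSum_le he hK ((L : ℝ) • x)
  calc _ ≤ δ * ((L : ℝ) ^ i * K) := by gcongr
    _ = _ := by ring

/-- For a small enough height coefficient, not depending on `L`, all boundary functions belong to
the Hölder class. -/
lemma exists_boundaryFun_mem_HolderClass (m : ℕ) {lam α : ℝ} (hlam : 1 ≤ lam) (hα : 0 < α) :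
    ∃ A₀ : ℝ, 0 < A₀ ∧ ∀ A : ℝ, 0 ≤ A → A ≤ A₀ → ∀ L : ℕ, 1 ≤ L →
      ∀ e : (Fin m → Fin L) → ℝ, (∀ j, |e j| ≤ 1) →
        boundaryFun (A * (L : ℝ) ^ (-α)) e ∈ HolderClass m lam α := by
  obtain ⟨K, hK1, hK⟩ := exists_bound_iteratedFDeriv_unitBump m ⌈α⌉₊
  refine ⟨1 / (2 * K), by positivity, fun A hA0 hA L hL e he => ?_⟩
  have hL1 : (1 : ℝ) ≤ L := by exact_mod_cast hL
  have hLα : 0 ≤ (L : ℝ) ^ (-α) := by positivity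
  refine mem_HolderClass_of_bounds (B := A * K) (L := L) hlam hα hL1 (by positivity) ?_
    (contDiff_boundaryFun _ e _) (fun z => ?_) fun j h1 hj z => ?_
  · rw [le_div_iff₀ (by positivity)] at hA; linarith
  · refine (abs_boundaryFun_sub_le (by positivity) he z).trans ?_
    have : A * 1 ≤ A * K := by gcongr
    nlinarith
  · refine (norm_iteratedFDeriv_boundaryFun_le (by positivity) he h1 (hK j hj) z).trans_eq ?_
    ring

end Bumps

/-! ### Hellinger affinity and two-point tests. -/

section Affinity

variable {Ω : Type*} [Fintype Ω]

/-- Le Cam's inequality: the testing affinity is at least half the squared Hellinger affinity. -/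
lemma sq_sum_sqrt_le_two_mul_sum_min {P Q : Ω → ℝ} (hP : ∀ x, 0 ≤ P x) (hQ : ∀ x, 0 ≤ Q x)
    (hP1 : ∑ x, P x = 1) (hQ1 : ∑ x, Q x = 1) :
    (∑ x, √(P x * Q x)) ^ 2 ≤ 2 * ∑ x, min (P x) (Q x) := by
  have h1 : ∀ x, √(P x * Q x) = √(min (P x) (Q x)) * √(max (P x) (Q x)) := fun x => by
    rw [← Real.sqrt_mul (le_min (hP x) (hQ x)), min_mul_max]
  have h2 : ∑ x, max (P x) (Q x) ≤ 2 := by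
    calc _ ≤ ∑ x, (P x + Q x) :=
          Finset.sum_le_sum fun x _ => max_le (by linarith [hQ x]) (by linarith [hP x])
      _ = 2 := by rw [Finset.sum_add_distrib, hP1, hQ1]; norm_num
  have h3 : 0 ≤ ∑ x, min (P x) (Q x) := Finset.sum_nonneg fun x _ => le_min (hP x) (hQ x)
  calc (∑ x, √(P x * Q x)) ^ 2
      = (∑ x, √(min (P x) (Q x)) * √(max (P x) (Q x))) ^ 2 := by simp_rw [h1]
    _ ≤ (∑ x, √(min (P x) (Q x)) ^ 2) * ∑ x, √(max (P x) (Q x)) ^ 2 :=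
        Finset.sum_mul_sq_le_sq_mul_sq _ _ _
    _ = (∑ x, min (P x) (Q x)) * ∑ x, max (P x) (Q x) := by
        congr 1 <;> refine Finset.sum_congr rfl fun x _ => Real.sq_sqrt ?_
        · exact le_min (hP x) (hQ x)
        · exact (hP x).trans (le_max_left _ _)
    _ ≤ _ := by nlinarith

/-- The sum of the two errors of a test between two product laws. -/
lemma half_affinity_pow_le_test_errors {p q : Ω → ℝ} (hp : ∀ x, 0 ≤ p x) (hq : ∀ x, 0 ≤ q x)
    (hp1 : ∑ x, p x = 1) (hq1 : ∑ x, q x = 1) (n : ℕ) (t : (Fin n → Ω) → Bool) (a : Bool) :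
    (∑ x, √(p x * q x)) ^ (2 * n) / 2 ≤
      (∑ D : Fin n → Ω, (∏ i, p (D i)) * if t D ≠ a then 1 else 0) +
        ∑ D : Fin n → Ω, (∏ i, q (D i)) * if t D ≠ !a then 1 else 0 := by
  have hP0 : ∀ D : Fin n → Ω, 0 ≤ ∏ i, p (D i) := fun D => Finset.prod_nonneg fun i _ => hp _
  have hQ0 : ∀ D : Fin n → Ω, 0 ≤ ∏ i, q (D i) := fun D => Finset.prod_nonneg fun i _ => hq _
  have h := sq_sum_sqrt_le_two_mul_sum_min hP0 hQ0
    (by rw [← Fintype.sum_pow, hp1, one_pow]) (by rw [← Fintype.sum_pow, hq1, one_pow])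
  have h1 : ∑ D : Fin n → Ω, √((∏ i, p (D i)) * ∏ i, q (D i)) = (∑ x, √(p x * q x)) ^ n := by
    rw [Fintype.sum_pow]
    refine Finset.sum_congr rfl fun D _ => ?_
    rw [← Finset.prod_mul_distrib, Real.sqrt_prod _ fun i _ => mul_nonneg (hp _) (hq _)]
  rw [h1, ← pow_mul, mul_comm n 2] at h
  have h2 : ∑ D : Fin n → Ω, min (∏ i, p (D i)) (∏ i, q (D i)) ≤
      (∑ D : Fin n → Ω, (∏ i, p (D i)) * if t D ≠ a then 1 else 0) +
        ∑ D : Fin n → Ω, (∏ i, q (D i)) * if t D ≠ !a then 1 else 0 := by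
    rw [← Finset.sum_add_distrib]
    -- On each sample exactly one of the two errors occurs, and it contributes one of the two
    -- probabilities, hence at least their minimum.
    refine Finset.sum_le_sum fun D _ => ?_
    by_cases hD : t D = a
    · simp [hD]
    · have : t D = !a := by cases hh : t D <;> cases a <;> simp_all
      simp [this]
  linarith

end Affinity

/-! ### Assouad's lemma on the hypercube of label patterns. -/

section Assouad

variable {J : Type*}

/-- The conditional law of the label, with bias `ε` towards the label `s j` at the site `j`. -/
noncomputable def labelProb (ε : ℝ) (s : J → Bool) : Option J → Bool → ℝ
  | none, _ => 1 / 2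
  | some j, b => if b = s j then 1 / 2 + ε else 1 / 2 - ε

lemma labelProb_nonneg {ε : ℝ} (hε0 : 0 ≤ ε) (hε1 : ε ≤ 1 / 2) (s : J → Bool) (i : Option J)
    (b : Bool) : 0 ≤ labelProb ε s i b := by
  cases i
  · simp [labelProb]
  · simp only [labelProb]; split_ifs <;> linarith

lemma labelProb_true_add_false (ε : ℝ) (s : J → Bool) (i : Option J) :
    labelProb ε s i true + labelProb ε s i false = 1 := by
  cases i with
  | none => simp only [labelProb]; norm_num
  | some j => cases h : s j <;> simp [labelProb, h] <;> ring

/-- Flip the `j`-th sign. -/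
def flipAt [DecidableEq J] (j : J) (s : J → Bool) : J → Bool := Function.update s j (!s j)

lemma flipAt_involutive [DecidableEq J] (j : J) : Function.Involutive (flipAt j) := by
  intro s
  simp [flipAt]

variable [Fintype J]

/-- The law of the location: mass `w` spread uniformly over `J`, and the rest at `none`. -/
noncomputable def siteWeight (w : ℝ) : Option J → ℝ
  | none => 1 - w
  | some _ => w / Fintype.card J

/-- The joint law of location and label. -/
noncomputable def siteLaw (w ε : ℝ) (s : J → Bool) (x : Option J × Bool) : ℝ :=
  siteWeight w x.1 * labelProb ε s x.1 x.2

lemma siteWeight_nonneg {w : ℝ} (hw0 : 0 ≤ w) (hw1 : w ≤ 1) (i : Option J) :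
    0 ≤ siteWeight w i := by
  cases i
  · simpa [siteWeight] using hw1
  · simp only [siteWeight]; positivity

lemma sum_siteWeight [Nonempty J] (w : ℝ) : ∑ i : Option J, siteWeight w i = 1 := by
  have : (Fintype.card J : ℝ) ≠ 0 := by exact_mod_cast Fintype.card_ne_zero
  simp only [Fintype.sum_option, siteWeight, Finset.sum_const, Finset.card_univ, nsmul_eq_mul]
  field_simp
  ring

lemma siteLaw_nonneg {w ε : ℝ} (hw0 : 0 ≤ w) (hw1 : w ≤ 1) (hε0 : 0 ≤ ε) (hε1 : ε ≤ 1 / 2)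
    (s : J → Bool) (x : Option J × Bool) : 0 ≤ siteLaw w ε s x :=
  mul_nonneg (siteWeight_nonneg hw0 hw1 _) (labelProb_nonneg hε0 hε1 _ _ _)

lemma sum_siteLaw [Nonempty J] (w ε : ℝ) (s : J → Bool) : ∑ x, siteLaw w ε s x = 1 := by
  simp only [Fintype.sum_prod_type, Fintype.sum_bool, siteLaw, ← mul_add,
    labelProb_true_add_false, mul_one, sum_siteWeight]

variable [DecidableEq J]

/-- The two laws differ only at the site `j`, of weight `v = w / |J|`. There both labels contribute
`v * √(1/4 - ε²)`, and `√(1/4 - ε²) ≥ 1/2 - 2ε²` because `ε ≤ 1/2`. -/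
lemma affinity_siteLaw_flipAt_ge [Nonempty J] {w ε : ℝ} (hw0 : 0 ≤ w) (hw1 : w ≤ 1)
    (hε0 : 0 ≤ ε) (hε1 : ε ≤ 1 / 2) (s : J → Bool) (j : J) :
    1 - 4 * (w * ε ^ 2 / Fintype.card J) ≤
      ∑ x, √(siteLaw w ε s x * siteLaw w ε (flipAt j s) x) := by
  set v : ℝ := w / Fintype.card J with hv
  have hv0 : 0 ≤ v := by positivity
  have hnone : ∀ b, √(siteLaw w ε s (none, b) * siteLaw w ε (flipAt j s) (none, b))
      = (1 - w) * (1 / 2) := fun b => by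
    simp only [siteLaw, siteWeight, labelProb]
    exact Real.sqrt_mul_self (by linarith)
  have hne : ∀ i ≠ j, ∀ b, √(siteLaw w ε s (some i, b) * siteLaw w ε (flipAt j s) (some i, b))
      = siteLaw w ε s (some i, b) := fun i hi b => by
    have : siteLaw w ε (flipAt j s) (some i, b) = siteLaw w ε s (some i, b) := by
      simp [siteLaw, labelProb, flipAt, hi]
    rw [this]
    exact Real.sqrt_mul_self (siteLaw_nonneg hw0 hw1 hε0 hε1 _ _)
  have heq : ∀ b, v * (1 / 2 - 2 * ε ^ 2) ≤
      √(siteLaw w ε s (some j, b) * siteLaw w ε (flipAt j s) (some j, b)) := fun b => by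
    have h1 : siteLaw w ε s (some j, b) * siteLaw w ε (flipAt j s) (some j, b)
        = v ^ 2 * (1 / 4 - ε ^ 2) := by
      by_cases hb : b = s j
      · simp [siteLaw, labelProb, siteWeight, flipAt, hb]; ring
      · have hb' : b = !s j := by cases b <;> cases h : s j <;> simp_all
        simp [siteLaw, labelProb, siteWeight, flipAt, hb']; ring
    rw [h1]
    refine Real.le_sqrt_of_sq_le ?_
    have h2 : 0 ≤ v ^ 2 * (ε ^ 2 * (1 - 4 * ε ^ 2)) := by
      have : 0 ≤ 1 - 4 * ε ^ 2 := by nlinarith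
      positivity
    nlinarith
  have hsome : ∀ i, v - (if i = j then 4 * (v * ε ^ 2) else 0) ≤
      ∑ b, √(siteLaw w ε s (some i, b) * siteLaw w ε (flipAt j s) (some i, b)) := fun i => by
    rw [Fintype.sum_bool]
    split_ifs with hi
    · rw [hi]; linarith [heq true, heq false]
    · rw [hne i hi, hne i hi]
      simp only [siteLaw, ← mul_add, labelProb_true_add_false, siteWeight]
      simp [hv]
  have hcard : (Fintype.card J : ℝ) ≠ 0 := by exact_mod_cast Fintype.card_ne_zero
  calc 1 - 4 * (w * ε ^ 2 / Fintype.card J)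
      = (1 - w) + ∑ i : J, (v - if i = j then 4 * (v * ε ^ 2) else 0) := by
        rw [Finset.sum_sub_distrib, Finset.sum_ite_eq' Finset.univ j, if_pos (Finset.mem_univ j),
          Finset.sum_const, Finset.card_univ, nsmul_eq_mul, hv]
        field_simp
        ring
    _ ≤ (1 - w) + ∑ i : J, ∑ b,
          √(siteLaw w ε s (some i, b) * siteLaw w ε (flipAt j s) (some i, b)) := by
        gcongr with i; exact hsome i
    _ = _ := by
        rw [Fintype.sum_prod_type, Fintype.sum_option, Fintype.sum_bool, hnone, hnone]
        ring

/-- Assouad's lemma for the laws `siteLaw`: every rule misclassifies, in expectation under one of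
the laws, at least an eighth of the sites. -/
lemma exists_card_div_eight_le_expected_errors [Nonempty J] {w ε : ℝ} (hw0 : 0 ≤ w) (hw1 : w ≤ 1)
    (hε0 : 0 ≤ ε) (hε1 : ε ≤ 1 / 2) {n : ℕ} (hn : 16 * (n * (w * ε ^ 2)) ≤ Fintype.card J)
    (t : (Fin n → Option J × Bool) → J → Bool) :
    ∃ s : J → Bool, (Fintype.card J : ℝ) / 8 ≤
      ∑ D : Fin n → Option J × Bool, (∏ i, siteLaw w ε s (D i)) *
        ∑ j, if t D j ≠ s j then (1 : ℝ) else 0 := by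
  have hcard : (0 : ℝ) < Fintype.card J := by exact_mod_cast Fintype.card_pos
  set F : J → (J → Bool) → ℝ := fun j s =>
    ∑ D : Fin n → Option J × Bool, (∏ i, siteLaw w ε s (D i)) * if t D j ≠ s j then 1 else 0
    with hF
  have hpair : ∀ j s, 1 / 4 ≤ F j s + F j (flipAt j s) := fun j s => by
    have h0 := siteLaw_nonneg hw0 hw1 hε0 hε1 (J := J)
    have h1 := half_affinity_pow_le_test_errors (h0 s) (h0 (flipAt j s)) (sum_siteLaw w ε s)
      (sum_siteLaw w ε _) n (fun D => t D j) (s j)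
    have h2 := affinity_siteLaw_flipAt_ge hw0 hw1 hε0 hε1 s j
    have h3 : (!s j) = flipAt j s j := by simp [flipAt]
    rw [h3] at h1
    refine le_trans ?_ h1
    have hx1 : w * ε ^ 2 / Fintype.card J ≤ 1 / 4 := by
      rw [div_le_iff₀ hcard]
      have : (1 : ℝ) ≤ Fintype.card J := by exact_mod_cast Fintype.card_pos
      nlinarith [sq_nonneg ε]
    set x := w * ε ^ 2 / Fintype.card J with hx
    have hnx : 16 * (n * x) ≤ 1 := by
      rw [hx, ← mul_div_assoc, ← mul_div_assoc, div_le_one hcard]; exact hn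
    -- Bernoulli: `(1 - 4x)^(2n) ≥ 1 - 8nx ≥ 1/2`, and the testing bound halves this to `1/4`.
    have h4 := one_add_mul_le_pow (a := -(4 * x)) (by linarith) (2 * n)
    push_cast at h4
    have h5 : (1 - 4 * x) ^ (2 * n) ≤
        (∑ y, √(siteLaw w ε s y * siteLaw w ε (flipAt j s) y)) ^ (2 * n) :=
      pow_le_pow_left₀ (by linarith) h2 _
    rw [← sub_eq_add_neg] at h4
    linarith
  -- Flipping permutes the sign patterns, so summing the pair bound counts each `F j s` twice and
  -- `1/4` becomes `1/8`.
  have hj : ∀ j, (Fintype.card (J → Bool) : ℝ) / 8 ≤ ∑ s, F j s := fun j => by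
    have h1 : ∑ s, F j (flipAt j s) = ∑ s, F j s :=
      Equiv.sum_comp (flipAt_involutive j).toPerm (F j)
    have h2 : ∑ _s : J → Bool, (1 / 4 : ℝ) ≤ ∑ s, (F j s + F j (flipAt j s)) :=
      Finset.sum_le_sum fun s _ => hpair j s
    rw [Finset.sum_add_distrib, h1, Finset.sum_const, Finset.card_univ, nsmul_eq_mul] at h2
    linarith
  have hsum : ∑ _s : J → Bool, (Fintype.card J : ℝ) / 8 ≤ ∑ s, ∑ j, F j s := by
    rw [Finset.sum_comm]
    calc _ = ∑ _j : J, (Fintype.card (J → Bool) : ℝ) / 8 := by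
          simp only [Finset.sum_const, Finset.card_univ, nsmul_eq_mul]; ring
      _ ≤ _ := Finset.sum_le_sum fun j _ => hj j
  obtain ⟨s, -, hs⟩ := Finset.exists_le_of_sum_le Finset.univ_nonempty hsum
  refine ⟨s, hs.trans_eq ?_⟩
  rw [hF, Finset.sum_comm]
  exact Finset.sum_congr rfl fun D _ => (Finset.mul_sum _ _ _).symm

end Assouad

/-! ### Finitely supported measures and their products. -/

/-- The measure with mass `q i` at the point `pt i`. -/
noncomputable def discreteMeasure {I X : Type*} [Fintype I] [MeasurableSpace X] (q : I → ℝ)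
    (pt : I → X) : Measure X :=
  ∑ i, ENNReal.ofReal (q i) • Measure.dirac (pt i)

section DiscreteMeasure

variable {I X : Type*} [Fintype I] [MeasurableSpace X] {q : I → ℝ} {pt : I → X}

instance : IsFiniteMeasure (discreteMeasure q pt) :=
  ⟨by simp [discreteMeasure, Measure.finsetSum_apply, ENNReal.sum_lt_top]⟩

lemma discreteMeasure_apply [MeasurableSingletonClass X] (A : Set X) :
    discreteMeasure q pt A = ∑ i, ENNReal.ofReal (q i) * A.indicator 1 (pt i) := by
  simp [discreteMeasure, Measure.finsetSum_apply]

lemma discreteMeasure_real_apply [MeasurableSingletonClass X] (hq : ∀ i, 0 ≤ q i) (A : Set X) :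
    (discreteMeasure q pt).real A = ∑ i, q i * A.indicator 1 (pt i) := by
  rw [Measure.real, discreteMeasure_apply, ENNReal.toReal_sum]
  · refine Finset.sum_congr rfl fun i _ => ?_
    rw [ENNReal.toReal_mul, ENNReal.toReal_ofReal (hq i)]
    by_cases h : pt i ∈ A <;> simp [h]
  · intro i _
    by_cases h : pt i ∈ A <;> simp [h]

lemma lintegral_discreteMeasure [MeasurableSingletonClass X] (f : X → ℝ≥0∞) :
    ∫⁻ x, f x ∂discreteMeasure q pt = ∑ i, ENNReal.ofReal (q i) * f (pt i) := by
  simp [discreteMeasure]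

lemma integral_discreteMeasure [MeasurableSingletonClass X] (hq : ∀ i, 0 ≤ q i) (f : X → ℝ) :
    ∫ x, f x ∂discreteMeasure q pt = ∑ i, q i * f (pt i) := by
  rw [discreteMeasure, integral_finsetSum_measure]
  · refine Finset.sum_congr rfl fun i _ => ?_
    rw [integral_smul_measure, integral_dirac, ENNReal.toReal_ofReal (hq i), smul_eq_mul]
  · intro i _
    exact (integrable_dirac (by simp)).smul_measure ENNReal.ofReal_ne_top

lemma discreteMeasure_singleton [MeasurableSpace I] [MeasurableSingletonClass I] (i : I) :
    discreteMeasure q id {i} = ENNReal.ofReal (q i) := by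
  rw [discreteMeasure_apply, Finset.sum_eq_single i] <;> simp +contextual

lemma map_discreteMeasure [MeasurableSpace I] [MeasurableSingletonClass I] :
    (discreteMeasure q id).map pt = discreteMeasure q pt := by
  refine Measure.ext fun A hA => ?_
  rw [Measure.map_apply (measurable_of_finite pt) hA, discreteMeasure_apply, discreteMeasure,
    Measure.finsetSum_apply]
  refine Finset.sum_congr rfl fun i _ => ?_
  rw [Measure.smul_apply, Measure.dirac_apply' _ hA, smul_eq_mul]
  rfl

lemma isProbabilityMeasure_discreteMeasure [MeasurableSingletonClass X] (hq : ∀ i, 0 ≤ q i)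
    (h1 : ∑ i, q i = 1) : IsProbabilityMeasure (discreteMeasure q pt) :=
  ⟨by rw [discreteMeasure_apply]; simp [← ENNReal.ofReal_sum_of_nonneg fun i _ => hq i, h1]⟩

/-- The integral of a function against a discrete product law. -/
lemma lintegral_pi_discreteMeasure (hq : ∀ i, 0 ≤ q i) {n : ℕ} {F : (Fin n → X) → ℝ}
    (hF : Measurable F) (hF0 : ∀ D, 0 ≤ F D) :
    ∫⁻ D, ENNReal.ofReal (F D) ∂(Measure.pi fun _ : Fin n => discreteMeasure q pt) =
      ENNReal.ofReal (∑ D : Fin n → I, (∏ k, q (D k)) * F fun k => pt (D k)) := by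
  let _ : MeasurableSpace I := ⊤
  have : MeasurableSingletonClass I := ⟨fun _ => trivial⟩
  -- The product law is the image of a product law on the finite index set, where integrals are
  -- finite sums; `pt` need not be injective.
  have h1 : (Measure.pi fun _ : Fin n => discreteMeasure q pt) =
      (Measure.pi fun _ : Fin n => discreteMeasure q id).map fun D k => pt (D k) := by
    rw [Measure.pi_map_pi fun _ => (measurable_of_finite pt).aemeasurable]
    simp_rw [map_discreteMeasure]
  have hm : Measurable fun (D : Fin n → I) k => pt (D k) := measurable_of_finite _
  rw [h1, lintegral_map hF.ennreal_ofReal hm, lintegral_fintype, ENNReal.ofReal_sum_of_nonneg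
    fun D _ => mul_nonneg (Finset.prod_nonneg fun _ _ => hq _) (hF0 _)]
  refine Finset.sum_congr rfl fun D _ => ?_
  rw [Measure.pi_singleton, ENNReal.ofReal_mul (Finset.prod_nonneg fun _ _ => hq _),
    ENNReal.ofReal_prod_of_nonneg fun _ _ => hq _, mul_comm]
  simp_rw [discreteMeasure_singleton]

end DiscreteMeasure

/-! ### Risks under a finitely supported marginal. -/

namespace ClassificationProblem

variable {d : ℕ} {I : Type*} [Fintype I] {P : ClassificationProblem d} {q : I → ℝ}
  {pt : I → FeatureSpace d}

/-- The conditional probability of a label. -/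
def condProb (P : ClassificationProblem d) (x : FeatureSpace d) (b : Bool) : ℝ :=
  if b then P.eta x else 1 - P.eta x

lemma condProb_nonneg {x : FeatureSpace d} (hx : x ∈ unitCube d) (b : Bool) :
    0 ≤ P.condProb x b := by
  have := P.eta_mem x hx
  cases b <;> simp [condProb, this.1, this.2]

lemma joint_of_discrete (hP : P.marginal = discreteMeasure q pt) (hq : ∀ i, 0 ≤ q i) :
    P.joint = discreteMeasure (fun x : I × Bool => q x.1 * P.condProb (pt x.1) x.2)
      fun x => (pt x.1, x.2) := by
  refine Measure.ext fun A hA => ?_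
  have hm : ∀ b : Bool, Measurable fun x : FeatureSpace d => (x, b) :=
    fun b => measurable_prodMk_right
  have key : ∀ (b : Bool) (φ : FeatureSpace d → ℝ),
      ((P.marginal.withDensity fun x => ENNReal.ofReal (φ x)).map (fun x => (x, b))) A =
        ∑ i, ENNReal.ofReal (q i * φ (pt i)) * A.indicator 1 (pt i, b) := fun b φ => by
    rw [Measure.map_apply (hm b) hA, withDensity_apply _ (hm b hA),
      ← lintegral_indicator (hm b hA), hP, lintegral_discreteMeasure]
    refine Finset.sum_congr rfl fun i _ => ?_
    rw [ENNReal.ofReal_mul (hq i)]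
    by_cases h : (pt i, b) ∈ A <;> simp [h]
  rw [joint, Measure.add_apply, key, key, discreteMeasure_apply, Fintype.sum_prod_type]
  simp only [Fintype.sum_bool, condProb, Finset.sum_add_distrib, if_true, Bool.false_eq_true,
    if_false]

/-- The excess risk over a discrete marginal. -/
lemma excessRisk_of_discrete (hP : P.marginal = discreteMeasure q pt) (hq : ∀ i, 0 ≤ q i)
    (hpt : ∀ i, pt i ∈ unitCube d) (f : FeatureSpace d → Bool) :
    P.excessRisk f =
      ∑ i, q i * (|1 - 2 * P.eta (pt i)| * if f (pt i) ≠ P.bayes (pt i) then 1 else 0) := by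
  have hrisk : ∀ f : FeatureSpace d → Bool, P.risk f =
      ∑ i, q i * if f (pt i) then 1 - P.eta (pt i) else P.eta (pt i) := fun f => by
    rw [risk, joint_of_discrete hP hq, discreteMeasure_real_apply
      fun x => mul_nonneg (hq _) (condProb_nonneg (hpt _) _), Fintype.sum_prod_type]
    refine Finset.sum_congr rfl fun i _ => ?_
    rw [Fintype.sum_bool]
    cases h : f (pt i) <;> simp [h, condProb]
  rw [excessRisk, hrisk, hrisk, ← Finset.sum_sub_distrib]
  refine Finset.sum_congr rfl fun i _ => ?_
  rw [← mul_sub]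
  congr 1
  by_cases hη : 1 / 2 ≤ P.eta (pt i)
  · have hb : P.bayes (pt i) = true := by simpa [bayes] using hη
    rw [abs_of_nonpos (by linarith), hb]
    cases f (pt i) <;> (simp; try ring)
  · have hb : P.bayes (pt i) = false := by simpa [bayes] using hη
    rw [abs_of_nonneg (by linarith), hb]
    cases f (pt i) <;> (simp; try ring)

lemma expectedExcessRisk_of_discrete (hP : P.marginal = discreteMeasure q pt)
    (hq : ∀ i, 0 ≤ q i) (hpt : ∀ i, pt i ∈ unitCube d) {n : ℕ}
    {f : (Fin n → FeatureSpace d × Bool) → FeatureSpace d → Bool} (hf : f ∈ PassiveRule d n) :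
    expectedExcessRisk P f = ENNReal.ofReal (∑ D : Fin n → I × Bool,
      (∏ k, q (D k).1 * P.condProb (pt (D k).1) (D k).2) *
        P.excessRisk (f fun k => (pt (D k).1, (D k).2))) := by
  have hf' : Measurable (Function.uncurry f) := hf
  rw [expectedExcessRisk, joint_of_discrete hP hq, lintegral_pi_discreteMeasure
    (q := fun x : I × Bool => q x.1 * P.condProb (pt x.1) x.2)
    (pt := fun x : I × Bool => (pt x.1, x.2)) (F := fun D => P.excessRisk (f D))
    fun x => mul_nonneg (hq _) (condProb_nonneg (hpt _) _)]
  · simp_rw [excessRisk_of_discrete hP hq hpt]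
    refine Finset.measurable_sum _ fun i _ => measurable_const.mul (measurable_const.mul ?_)
    have h1 : Measurable fun D => f D (pt i) := hf'.comp measurable_prodMk_right
    exact (measurable_of_finite fun b : Bool =>
      if b ≠ P.bayes (pt i) then (1 : ℝ) else 0).comp h1
  · intro D
    rw [excessRisk_of_discrete hP hq hpt]
    exact Finset.sum_nonneg fun i _ => mul_nonneg (hq i)
      (mul_nonneg (abs_nonneg _) (by split_ifs <;> norm_num))

end ClassificationProblem

/-! ### The extremal regression function. -/

section RegressionFunction

variable {d : ℕ}

/-- The regression function that satisfies the noise condition with equality. -/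
noncomputable def noiseEta (c κ : ℝ) (g : (Fin (d - 1) → ℝ) → ℝ) (x : FeatureSpace d) : ℝ :=
  if g x.1 ≤ x.2 then 1 / 2 + c * |x.2 - g x.1| ^ (κ - 1)
  else 1 / 2 - c * |x.2 - g x.1| ^ (κ - 1)

variable {c κ : ℝ} {g : (Fin (d - 1) → ℝ) → ℝ}

lemma abs_noiseEta_sub_half (hc : 0 < c) (x : FeatureSpace d) :
    |noiseEta c κ g x - 1 / 2| = c * |x.2 - g x.1| ^ (κ - 1) := by
  have h : 0 ≤ c * |x.2 - g x.1| ^ (κ - 1) := by positivity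
  rw [noiseEta]
  split_ifs
  · rw [add_sub_cancel_left, abs_of_nonneg h]
  · rw [sub_sub_cancel_left, abs_neg, abs_of_nonneg h]

lemma half_le_noiseEta_iff (hc : 0 < c) (x : FeatureSpace d) :
    1 / 2 ≤ noiseEta c κ g x ↔ g x.1 ≤ x.2 := by
  rw [noiseEta]
  split_ifs with h
  · simp only [h, iff_true, le_add_iff_nonneg_right]
    positivity
  · have h1 : 0 < |x.2 - g x.1| := abs_pos.2 (by intro h0; apply h; linarith)
    have h2 : 0 < c * |x.2 - g x.1| ^ (κ - 1) := by positivity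
    simp only [h, iff_false, not_le]
    linarith

lemma measurable_noiseEta (hg : Measurable g) : Measurable (noiseEta c κ g) := by
  have h1 : Measurable fun x : FeatureSpace d => g x.1 := hg.comp measurable_fst
  have h2 : Measurable fun x : FeatureSpace d => c * |x.2 - g x.1| ^ (κ - 1) :=
    measurable_const.mul (((measurable_snd.sub h1).norm).pow_const (κ - 1))
  exact Measurable.ite (measurableSet_le h1 measurable_snd) (measurable_const.add h2)
    (measurable_const.sub h2)

end RegressionFunction

/-! ### The hard problems and their minimax risk. -/

section Construction

variable {d L : ℕ}

/-- The atoms of the marginal law: the points of height `1/2` over the centres of the cells and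
over the origin. -/
noncomputable def site (d L : ℕ) : Option (Fin (d - 1) → Fin L) → FeatureSpace d
  | none => (0, 1 / 2)
  | some j => ((L : ℝ)⁻¹ • cellCenter j, 1 / 2)

lemma site_mem_unitCube (hL : 0 < L) (i : Option (Fin (d - 1) → Fin L)) :
    site d L i ∈ unitCube d := by
  have hL' : (0 : ℝ) < L := by exact_mod_cast hL
  have h2 : (1 / 2 : ℝ) ∈ Icc (0 : ℝ) 1 := ⟨by norm_num, by norm_num⟩
  cases i with
  | none => exact ⟨⟨le_rfl, zero_le_one⟩, h2⟩
  | some j =>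
    refine ⟨⟨fun k => ?_, fun k => ?_⟩, h2⟩
    · simp only [site, cellCenter, Pi.smul_apply, smul_eq_mul, Pi.zero_apply]
      positivity
    · simp only [site, cellCenter, Pi.smul_apply, smul_eq_mul, Pi.one_apply]
      rw [inv_mul_le_iff₀ hL', mul_one]
      have : ((j k : ℕ) : ℝ) + 1 ≤ L := by exact_mod_cast (j k).isLt
      linarith

/-- The sign of the bump that makes `b` the Bayes label below it. -/
def bumpSign (b : Bool) : ℝ := if b then -1 else 1

lemma abs_bumpSign (b : Bool) : |bumpSign b| = 1 := by
  cases b <;> simp [bumpSign]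

/-- The boundary function whose Bayes labels at the sites are `s`. -/
noncomputable def signedBoundary (δ : ℝ) (s : (Fin (d - 1) → Fin L) → Bool) :
    (Fin (d - 1) → ℝ) → ℝ :=
  boundaryFun δ fun j => bumpSign (s j)

variable {δ c κ : ℝ} {s : (Fin (d - 1) → Fin L) → Bool}

/-- All boundaries pass through this point, and `0 ^ (κ - 1) = 0` as `κ ≠ 1`. The mass placed here
is therefore harmless. -/
lemma noiseEta_site_none (hd : 2 ≤ d) (hκ : 1 < κ) :
    noiseEta c κ (signedBoundary δ s) (site d L none) = 1 / 2 := by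
  have h : signedBoundary δ s (0 : Fin (d - 1) → ℝ) = 1 / 2 := boundaryFun_zero (by omega) _ _
  simp [noiseEta, site, h, Real.zero_rpow (by linarith : κ - 1 ≠ 0)]

lemma signedBoundary_center (hL : 0 < L) (j : Fin (d - 1) → Fin L) :
    signedBoundary δ s ((L : ℝ)⁻¹ • cellCenter j) = 1 / 2 + δ * bumpSign (s j) :=
  boundaryFun_center hL _ _ j

lemma noiseEta_site_some (hL : 0 < L) (hδ : 0 < δ) (j : Fin (d - 1) → Fin L) :
    noiseEta c κ (signedBoundary δ s) (site d L (some j)) =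
      if s j then 1 / 2 + c * δ ^ (κ - 1) else 1 / 2 - c * δ ^ (κ - 1) := by
  simp only [noiseEta, site, signedBoundary_center hL]
  cases h : s j
  · simp [bumpSign, not_le.2 hδ, abs_of_pos hδ]
  · simp [bumpSign, hδ.le, abs_of_pos hδ]

lemma abs_site_sub_signedBoundary (hL : 0 < L) (hδ : 0 < δ) (j : Fin (d - 1) → Fin L) :
    |(site d L (some j)).2 - signedBoundary δ s (site d L (some j)).1| = δ := by
  simp only [site, signedBoundary_center hL]
  cases s j <;> simp [bumpSign, abs_of_pos hδ]

/-- The problem with boundary `signedBoundary δ s`, noise exponent `κ`, and marginal of mass `w`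
on the sites over the cells. -/
lemma exists_siteProblem (hd : 2 ≤ d) (hL : 0 < L) {lam α c κ M Δ₀ κ' δ w : ℝ}
    (hκ : 1 < κ) (hκ' : 0 < κ') (hc : 0 < c) (hM : 0 < M) (hδ : 0 < δ)
    (hcδ : c * (1 / 2 + δ) ^ (κ - 1) ≤ 1 / 2) (hw0 : 0 ≤ w) (hw1 : w ≤ 1)
    (hwM : w * (2 * (c * δ ^ (κ - 1))) ≤ M * δ ^ κ') (s : (Fin (d - 1) → Fin L) → Bool)
    (hs : signedBoundary δ s ∈ HolderClass (d - 1) lam α) :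
    ∃ P ∈ problemClass d lam α c κ M Δ₀ κ',
      P.marginal = discreteMeasure (siteWeight w) (site d L) ∧
      P.eta = noiseEta c κ (signedBoundary δ s) := by
  have : NeZero L := ⟨hL.ne'⟩
  have hcont : Continuous (signedBoundary δ s) := (contDiff_boundaryFun δ _ 0).continuous
  have hq := siteWeight_nonneg (J := Fin (d - 1) → Fin L) hw0 hw1
  have hbd : ∀ x ∈ unitCube d, |x.2 - signedBoundary δ s x.1| ≤ 1 / 2 + δ := fun x hx => by
    have h1 := abs_le.1 (abs_boundaryFun_sub_le hδ.le (fun j => (abs_bumpSign (s j)).le) x.1)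
    obtain ⟨h2, h3⟩ := hx.2
    rw [abs_le]
    constructor <;> simp only [signedBoundary] <;> linarith
  have heta : ∀ x ∈ unitCube d, noiseEta c κ (signedBoundary δ s) x ∈ Icc (0 : ℝ) 1 :=
    fun x hx => by
      have h1 := abs_noiseEta_sub_half (κ := κ) (g := signedBoundary δ s) hc x
      have h2 : c * |x.2 - signedBoundary δ s x.1| ^ (κ - 1) ≤ 1 / 2 :=
        le_trans (by gcongr; exact hbd x hx) hcδ
      rw [← h1] at h2
      have h3 := abs_le.1 h2
      constructor <;> linarith
  let P : ClassificationProblem d :=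
    { marginal := discreteMeasure (siteWeight w) (site d L)
      isProb := isProbabilityMeasure_discreteMeasure hq (sum_siteWeight w)
      supported := by
        rw [discreteMeasure_apply]
        exact Finset.sum_eq_zero fun i _ => by simp [site_mem_unitCube hL i]
      eta := noiseEta c κ (signedBoundary δ s)
      measurable_eta := measurable_noiseEta hcont.measurable
      eta_mem := heta }
  refine ⟨P, ⟨signedBoundary δ s, hs, ?_, fun x _ => (abs_noiseEta_sub_half hc x).ge,
    fun Δ hΔ => ?_⟩, rfl, rfl⟩
  · ext x
    simp only [epi, mem_ofPred_eq, P, half_le_noiseEta_iff hc]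
  · set A := {x : FeatureSpace d | x ∈ unitCube d ∧ |x.2 - signedBoundary δ s x.1| ≤ Δ} with hA
    have hAm : MeasurableSet A := by
      refine MeasurableSet.inter (measurableSet_Icc.prod measurableSet_Icc) ?_
      have hc' : Continuous fun x : FeatureSpace d => |x.2 - signedBoundary δ s x.1| :=
        (continuous_snd.sub (hcont.comp continuous_fst)).abs
      exact (isClosed_le hc' continuous_const).measurableSet
    rw [← integral_indicator hAm]
    change ∫ x, A.indicator (fun x => |1 - 2 * noiseEta c κ (signedBoundary δ s) x|) x
      ∂discreteMeasure (siteWeight w) (site d L) ≤ _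
    have hε0 : 0 ≤ c * δ ^ (κ - 1) := by positivity
    rw [integral_discreteMeasure hq, Fintype.sum_option]
    have hnone : A.indicator (fun x => |1 - 2 * noiseEta c κ (signedBoundary δ s) x|)
        (site d L none) = 0 := by
      rw [indicator_apply_eq_zero]
      intro _
      rw [noiseEta_site_none hd hκ]
      norm_num
    rw [hnone, mul_zero, zero_add]
    -- The sites over the cells lie at vertical distance exactly `δ` from the boundary: for `Δ < δ`
    -- none counts, and for `Δ ≥ δ` their total `w * 2ε` is at most `M * δ ^ κ' ≤ M * Δ ^ κ'`.
    rcases lt_or_ge Δ δ with h | h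
    · have hsome : ∀ j, site d L (some j) ∉ A := fun j hj => by
        have := hj.2
        rw [abs_site_sub_signedBoundary hL hδ] at this
        linarith
      simp only [indicator_of_notMem (hsome _), mul_zero, Finset.sum_const_zero]
      have := hΔ.1
      positivity
    · have hsome : ∀ j, A.indicator (fun x => |1 - 2 * noiseEta c κ (signedBoundary δ s) x|)
          (site d L (some j)) ≤ 2 * (c * δ ^ (κ - 1)) := fun j => by
        refine indicator_apply_le' (fun _ => ?_) fun _ => by positivity
        rw [noiseEta_site_some hL hδ, abs_le]
        split_ifs <;> constructor <;> linarith
      calc _ ≤ ∑ j : Fin (d - 1) → Fin L, siteWeight w (some j) * (2 * (c * δ ^ (κ - 1))) :=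
            Finset.sum_le_sum fun j _ => mul_le_mul_of_nonneg_left (hsome j) (hq _)
        _ = w * (2 * (c * δ ^ (κ - 1))) := by
            have hcard : (Fintype.card (Fin (d - 1) → Fin L) : ℝ) ≠ 0 := by
              exact_mod_cast Fintype.card_ne_zero
            simp only [siteWeight, Finset.sum_const, Finset.card_univ, nsmul_eq_mul]
            field_simp
        _ ≤ M * δ ^ κ' := hwM
        _ ≤ M * Δ ^ κ' := by gcongr

/-- The lower bound for given numbers of samples and of cells. -/
lemma le_passiveMinimaxRisk (hd : 2 ≤ d) (hL : 0 < L) {lam α c κ M Δ₀ κ' δ w : ℝ} {n : ℕ}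
    (hκ : 1 < κ) (hκ' : 0 < κ') (hc : 0 < c) (hM : 0 < M) (hδ : 0 < δ)
    (hcδ : c * (1 / 2 + δ) ^ (κ - 1) ≤ 1 / 2) (hw0 : 0 ≤ w) (hw1 : w ≤ 1)
    (hwM : w * (2 * (c * δ ^ (κ - 1))) ≤ M * δ ^ κ')
    (hs : ∀ s : (Fin (d - 1) → Fin L) → Bool,
      signedBoundary δ s ∈ HolderClass (d - 1) lam α)
    (hn : 16 * (n * (w * (c * δ ^ (κ - 1)) ^ 2)) ≤ (L : ℝ) ^ (d - 1)) :
    ENNReal.ofReal (w * (c * δ ^ (κ - 1)) / 4) ≤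
      passiveMinimaxRisk (problemClass d lam α c κ M Δ₀ κ') n := by
  have : NeZero L := ⟨hL.ne'⟩
  set ε := c * δ ^ (κ - 1) with hε
  have hε0 : 0 < ε := by positivity
  have hε1 : ε ≤ 1 / 2 := le_trans (by rw [hε]; gcongr; linarith) hcδ
  have hcard : (Fintype.card (Fin (d - 1) → Fin L) : ℝ) = (L : ℝ) ^ (d - 1) := by simp
  have hcard0 : (0 : ℝ) < Fintype.card (Fin (d - 1) → Fin L) := by
    exact_mod_cast Fintype.card_pos
  refine le_iInf₂ fun f hf => ?_
  let t : (Fin n → Option (Fin (d - 1) → Fin L) × Bool) → (Fin (d - 1) → Fin L) → Bool :=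
    fun D j => f (fun k => (site d L (D k).1, (D k).2)) (site d L (some j))
  obtain ⟨s, hserr⟩ := exists_card_div_eight_le_expected_errors hw0 hw1 hε0.le hε1
    (by rwa [hcard]) t
  obtain ⟨P, hPmem, hPm, hPη⟩ := exists_siteProblem (Δ₀ := Δ₀) hd hL hκ hκ' hc hM hδ hcδ hw0 hw1
    hwM s (hs s)
  refine le_iSup₂_of_le P hPmem ?_
  have hq := siteWeight_nonneg (J := Fin (d - 1) → Fin L) hw0 hw1
  rw [P.expectedExcessRisk_of_discrete hPm hq (site_mem_unitCube hL) hf]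
  refine ENNReal.ofReal_le_ofReal ?_
  have hlaw : ∀ x : Option (Fin (d - 1) → Fin L) × Bool,
      siteWeight w x.1 * P.condProb (site d L x.1) x.2 = siteLaw w ε s x := by
    rintro ⟨i, b⟩
    simp only [siteLaw, ClassificationProblem.condProb, hPη]
    cases i with
    | none =>
      rw [noiseEta_site_none hd hκ]
      cases b <;> norm_num [labelProb]
    | some j =>
      rw [noiseEta_site_some hL hδ]
      cases b <;> cases h : s j <;> simp [labelProb, h, ← hε] <;> left <;> ring
  have hbayes : ∀ j, P.bayes (site d L (some j)) = s j := fun j => by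
    rw [ClassificationProblem.bayes, hPη, noiseEta_site_some hL hδ, ← hε]
    cases s j <;> simp [hε0, hε0.le]
  have habs : ∀ j, |1 - 2 * P.eta (site d L (some j))| = 2 * ε := fun j => by
    rw [hPη, noiseEta_site_some hL hδ, ← hε]
    split_ifs
    · rw [abs_of_nonpos (by linarith)]; ring
    · rw [abs_of_nonneg (by linarith)]; ring
  have hexcess : ∀ D : Fin n → Option (Fin (d - 1) → Fin L) × Bool,
      P.excessRisk (f fun k => (site d L (D k).1, (D k).2)) =
        w / Fintype.card (Fin (d - 1) → Fin L) * (2 * ε) *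
          ∑ j, if t D j ≠ s j then (1 : ℝ) else 0 := fun D => by
    rw [P.excessRisk_of_discrete hPm hq (site_mem_unitCube hL), Fintype.sum_option,
      hPη, noiseEta_site_none hd hκ, ← hPη, Finset.mul_sum]
    simp only [habs, hbayes, siteWeight]
    norm_num [t, mul_assoc]
  simp_rw [hlaw, hexcess]
  -- An error at one site costs `(w / |J|) * 2ε`, and at least `|J| / 8` errors are expected.
  calc w * ε / 4 = w / Fintype.card (Fin (d - 1) → Fin L) * (2 * ε) *
        (Fintype.card (Fin (d - 1) → Fin L) / 8) := by field_simp; ring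
    _ ≤ w / Fintype.card (Fin (d - 1) → Fin L) * (2 * ε) *
        ∑ D : Fin n → Option (Fin (d - 1) → Fin L) × Bool, (∏ i, siteLaw w ε s (D i)) *
          ∑ j, if t D j ≠ s j then (1 : ℝ) else 0 := by gcongr
    _ = _ := by
      rw [Finset.mul_sum]
      exact Finset.sum_congr rfl fun D _ => by ring

end Construction

/-! ### Choice of the parameters and comparison of the rates. -/

/-- The condition on `c` says `c * (1/2)^(κ-1) < 1/2`, and continuity leaves room for a small `A`.
Points of the cube are within `1/2 + A` of a boundary of amplitude at most `A`, so this keeps the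
regression function in `[0,1]`. -/
lemma exists_pos_mul_rpow_le_half {c κ : ℝ} (hκ : 1 < κ) (hc' : c < 2 ^ (κ - 2)) {A₀ : ℝ}
    (hA₀ : 0 < A₀) :
    ∃ A : ℝ, 0 < A ∧ A ≤ A₀ ∧ c * (1 / 2 + A) ^ (κ - 1) ≤ 1 / 2 := by
  have h0 : c * (1 / 2 + 0 : ℝ) ^ (κ - 1) < 1 / 2 := by
    have h1 : (0 : ℝ) < (1 / 2 : ℝ) ^ (κ - 1) := by positivity
    calc c * (1 / 2 + 0 : ℝ) ^ (κ - 1) < 2 ^ (κ - 2) * (1 / 2 : ℝ) ^ (κ - 1) := by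
          rw [add_zero]; gcongr
      _ = 1 / 2 := by
          rw [one_div, Real.inv_rpow (by norm_num), ← Real.rpow_neg (by norm_num),
            ← Real.rpow_add (by norm_num), show κ - 2 + -(κ - 1) = -1 by ring,
            Real.rpow_neg_one]
  have hcont : Continuous fun A : ℝ => c * (1 / 2 + A) ^ (κ - 1) :=
    continuous_const.mul ((continuous_const.add continuous_id).rpow_const
      fun _ => Or.inr (by linarith))
  have hev : ∀ᶠ A in 𝓝[>] (0 : ℝ), c * (1 / 2 + A) ^ (κ - 1) < 1 / 2 :=
    nhdsWithin_le_nhds (hcont.continuousAt.eventually_lt continuousAt_const h0)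
  obtain ⟨A, h1, h2⟩ := (hev.and (Ioc_mem_nhdsGT hA₀)).exists
  exact ⟨A, h2.1, h2.2, h1.le⟩

lemma exists_nat_rpow_ge {x r : ℝ} (hx : 1 ≤ x) (hr : 0 < r) :
    ∃ L : ℕ, 1 ≤ L ∧ x ≤ (L : ℝ) ^ r ∧ (L : ℝ) ≤ 2 * x ^ r⁻¹ := by
  have h1 : 1 ≤ x ^ r⁻¹ := Real.one_le_rpow hx (by positivity)
  refine ⟨⌈x ^ r⁻¹⌉₊, Nat.one_le_ceil_iff.2 (by linarith), ?_, ?_⟩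
  · calc x = (x ^ r⁻¹) ^ r := (Real.rpow_inv_rpow (by linarith) hr.ne').symm
      _ ≤ _ := Real.rpow_le_rpow (by positivity) (Nat.le_ceil _) hr.le
  · linarith [Nat.ceil_lt_add_one (by linarith : 0 ≤ x ^ r⁻¹)]

/-- The denominators differ by `α * (κ' - (κ - 1)) > 0`. -/
lemma passiveExponent_lt_activeExponent {d : ℕ} (hd : 2 ≤ d) {α κ κ' : ℝ} (hα : 0 < α)
    (hκ : 1 < κ) (hκ' : κ - 1 < κ') : passiveExponent d α κ κ' < activeExponent d α κ κ' := by
  have hd' : (2 : ℝ) ≤ d := by exact_mod_cast hd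
  have h1 : 0 < α * (κ - 1) := mul_pos hα (by linarith)
  have h2 : α * (κ - 1) < α * κ' := by gcongr
  refine div_lt_div_of_pos_left (mul_pos hα (by linarith)) ?_ ?_ <;> nlinarith

lemma isLittleO_log_rpow_mul_rpow_neg {a b : ℝ} (hab : a < b) (q : ℝ) :
    (fun n : ℕ => Real.log n ^ q * (n : ℝ) ^ (-b)) =o[atTop] fun n : ℕ => (n : ℝ) ^ (-a) := by
  have h1 := (isLittleO_log_rpow_rpow_atTop q (sub_pos.2 hab)).comp_tendsto
    tendsto_natCast_atTop_atTop (α := ℝ)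
  have h2 := h1.mul_isBigO (isBigO_refl (fun n : ℕ => (n : ℝ) ^ (-b)) atTop)
  refine h2.congr' EventuallyEq.rfl ?_
  filter_upwards [eventually_gt_atTop 0] with n hn
  rw [Function.comp_apply, ← Real.rpow_add (by exact_mod_cast hn)]
  ring_nf

lemma exists_passiveMinimaxRisk_lower_bound (d : ℕ) (hd : 2 ≤ d) (lam α c κ M Δ₀ κ' : ℝ)
    (hlam : 1 ≤ lam) (hα : 0 < α) (hκ : 1 < κ) (hκ' : κ - 1 < κ')
    (hc : 0 < c) (hc' : c < 2 ^ (κ - 2)) (hM : 0 < M) :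
    ∃ C : ℝ, 0 < C ∧ ∃ N : ℕ, ∀ n : ℕ, N ≤ n →
      ENNReal.ofReal (C * (n : ℝ) ^ (-passiveExponent d α κ κ')) ≤
        passiveMinimaxRisk (problemClass d lam α c κ M Δ₀ κ') n := by
  have hκ'0 : 0 < κ' := by linarith
  have hd' : (2 : ℝ) ≤ d := by exact_mod_cast hd
  obtain ⟨A₀, hA₀, hHolder⟩ := exists_boundaryFun_mem_HolderClass (d - 1) hlam hα
  obtain ⟨A, hA, hAA₀, hcA⟩ := exists_pos_mul_rpow_le_half hκ hc' (lt_min hA₀ one_pos)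
  have hA1 : A ≤ 1 := hAA₀.trans (min_le_right _ _)
  set r := α * (κ + κ' - 1) + (d - 1) with hr
  have hr0 : 0 < r := by
    have : 0 < α * (κ + κ' - 1) := mul_pos hα (by linarith)
    linarith
  -- The `1` ensures `w ≤ 1`; the other term ensures `2wε ≤ M * δ ^ κ'`.
  set W := min 1 (M / (2 * c)) with hW
  have hW0 : 0 < W := lt_min one_pos (by positivity)
  have hW1 : W ≤ 1 := min_le_left _ _
  have hWM : 2 * c * W ≤ M := by
    have := min_le_right 1 (M / (2 * c))
    rw [← hW, le_div_iff₀ (by positivity)] at this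
    linarith
  set B := 16 * c ^ 2 with hB
  have hB0 : 0 < B := by positivity
  -- The constant is `wε/4 = W * c * δ^κ' / 4` evaluated with `δ = A * L^(-α)` and `L ≤ 2 * (B *
  -- n)^(1/r)`. The threshold makes `B * n ≥ 1`, so that rounding `L` up costs at most a factor `2`.
  refine ⟨W * c / 4 * A ^ κ' * (2 * B ^ r⁻¹) ^ (-(α * κ')), by positivity, ⌈B⁻¹⌉₊,
    fun n hn => ?_⟩
  have hBn : 1 ≤ B * n := by
    have := Nat.ceil_le.1 hn
    rwa [inv_le_iff_one_le_mul₀' hB0] at this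
  have hn0 : (0 : ℝ) < n := pos_of_mul_pos_right (by linarith) hB0.le
  obtain ⟨L, hL1, hL2, hL3⟩ := exists_nat_rpow_ge hBn hr0
  have hL0 : (0 : ℝ) < L := by exact_mod_cast hL1
  have hLα1 : (L : ℝ) ^ (-α) ≤ 1 :=
    Real.rpow_le_one_of_one_le_of_nonpos (by exact_mod_cast hL1) (by linarith)
  have hLα0 : 0 < (L : ℝ) ^ (-α) := Real.rpow_pos_of_pos hL0 _
  set δ := A * (L : ℝ) ^ (-α) with hδ
  have hδ0 : 0 < δ := by positivity
  have hδA : δ ≤ A := mul_le_of_le_one_right hA.le hLα1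
  have hδL : δ ≤ (L : ℝ) ^ (-α) := mul_le_of_le_one_left hLα0.le hA1
  -- The exponent is positive because `κ' > κ - 1`, so `δ ≤ 1` gives `w ≤ 1`.
  set w := W * δ ^ (κ' - (κ - 1)) with hw
  have hwδ : w * (c * δ ^ (κ - 1)) = W * c * δ ^ κ' := by
    have : δ ^ κ' = δ ^ (κ' - (κ - 1)) * δ ^ (κ - 1) := by
      rw [← Real.rpow_add hδ0]; ring_nf
    rw [this, hw]; ring
  have hmain := le_passiveMinimaxRisk (Δ₀ := Δ₀) (lam := lam) (α := α) (M := M) (κ' := κ')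
    (δ := δ) (w := w) (n := n) hd hL1 hκ hκ'0 hc hM hδ0
    (le_trans (by gcongr) hcA) (by positivity)
    (mul_le_one₀ hW1 (by positivity) (Real.rpow_le_one hδ0.le (hδA.trans hA1) (by linarith)))
    (by
      rw [mul_left_comm, hwδ, ← mul_assoc, ← mul_assoc]
      refine mul_le_mul_of_nonneg_right (by linarith) (by positivity))
    (fun s => hHolder A hA.le (hAA₀.trans (min_le_left _ _)) L hL1 _
      fun j => (abs_bumpSign (s j)).le)
    (by
      have h1 : w * (c * δ ^ (κ - 1)) ^ 2 = W * c ^ 2 * δ ^ (κ + κ' - 1) := by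
        have : δ ^ (κ + κ' - 1) = δ ^ κ' * δ ^ (κ - 1) := by
          rw [← Real.rpow_add hδ0]; ring_nf
        rw [sq, ← mul_assoc, hwδ, this]; ring
      have h2 : δ ^ (κ + κ' - 1) ≤ (L : ℝ) ^ (-(α * (κ + κ' - 1))) := by
        rw [← neg_mul, Real.rpow_mul hL0.le]
        exact Real.rpow_le_rpow hδ0.le hδL (by linarith)
      have h3 : (L : ℝ) ^ (d - 1) = (L : ℝ) ^ r * (L : ℝ) ^ (-(α * (κ + κ' - 1))) := by
        rw [← Real.rpow_add hL0, ← Real.rpow_natCast, Nat.cast_sub (by omega), hr]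
        congr 1
        push_cast
        ring
      rw [h1, h3]
      calc 16 * (n * (W * c ^ 2 * δ ^ (κ + κ' - 1)))
          = W * (B * n * δ ^ (κ + κ' - 1)) := by rw [hB]; ring
        _ ≤ 1 * ((L : ℝ) ^ r * (L : ℝ) ^ (-(α * (κ + κ' - 1)))) := by gcongr
        _ = _ := one_mul _)
  refine le_trans (ENNReal.ofReal_le_ofReal ?_) hmain
  rw [hwδ]
  have h4 : (2 * B ^ r⁻¹) ^ (-(α * κ')) * (n : ℝ) ^ (-passiveExponent d α κ κ')
      = (2 * (B * n) ^ r⁻¹) ^ (-(α * κ')) := by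
    rw [Real.mul_rpow hB0.le hn0.le, ← mul_assoc,
      Real.mul_rpow (x := 2 * B ^ r⁻¹) (by positivity) (by positivity), ← Real.rpow_mul hn0.le]
    congr 2
    rw [passiveExponent, ← hr]
    field_simp
  have h5 : (2 * (B * n) ^ r⁻¹) ^ (-(α * κ')) ≤ (L : ℝ) ^ (-(α * κ')) :=
    Real.rpow_le_rpow_of_nonpos hL0 hL3 (by nlinarith [mul_pos hα hκ'0])
  have h6 : δ ^ κ' = A ^ κ' * (L : ℝ) ^ (-(α * κ')) := by
    rw [hδ, Real.mul_rpow hA.le hLα0.le, ← Real.rpow_mul hL0.le, neg_mul]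
  rw [mul_assoc, h4, h6]
  calc _ ≤ W * c / 4 * A ^ κ' * (L : ℝ) ^ (-(α * κ')) := by gcongr
    _ = _ := by ring

theorem theorem6 (d : ℕ) (hd : 2 ≤ d) (lam α c κ M Δ₀ κ' : ℝ)
    (hlam : 1 ≤ lam) (hα : 0 < α) (hκ : 1 < κ) (hκ' : κ - 1 < κ')
    (hc : 0 < c) (hc' : c < 2 ^ (κ - 2)) (hM : 0 < M) (hΔ₀ : 0 < Δ₀) :
    (∃ C : ℝ, 0 < C ∧ ∃ N : ℕ, ∀ n : ℕ, N ≤ n →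
      ENNReal.ofReal (C * (n : ℝ) ^ (-passiveExponent d α κ κ')) ≤
        passiveMinimaxRisk (problemClass d lam α c κ M Δ₀ κ') n) ∧
    passiveExponent d α κ κ' < activeExponent d α κ κ' ∧
    ∀ q : ℝ, (fun n : ℕ => Real.log n ^ q * (n : ℝ) ^ (-activeExponent d α κ κ'))
      =o[atTop] fun n : ℕ => (n : ℝ) ^ (-passiveExponent d α κ κ') :=
  ⟨exists_passiveMinimaxRisk_lower_bound d hd lam α c κ M Δ₀ κ' hlam hα hκ hκ' hc hc' hM,
    passiveExponent_lt_activeExponent hd hα hκ hκ',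
    isLittleO_log_rpow_mul_rpow_neg (passiveExponent_lt_activeExponent hd hα hκ hκ')⟩
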